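/- For a map $f$ of $\mathbb{R}^2$ (or of $\mathbb{C}$, identified with $\mathbb{R}^2$) to itself, the escaping set $I(f)$ is the set of points $x$ whose orbit $(f^n(x))_{n\ge 0}$ tends to infinity, the bounded orbit set $BO(f)$ is the set of points whose orbit is bounded, and the bungee set $BU(f)$ is the complement of $I(f)\cup BO(f)$. A homeomorphism $f:\mathbb{R}^2\to\mathbb{R}^2$ is quasiconformal if it belongs to the local Sobolev space $W^{1,2}_{\mathrm{loc}}$ and there is a constant $K\ge 1$ such that its weak derivative satisfies $|Df(x)|^2\le K\det Df(x)$ for almost every $x$, where $|Df(x)|$ is the operator norm. **Theorem.** There is a quasiconformal homeomorphism $f:\mathbb{R}^2\to\mathbb{R}^2$ such that $BU(f)\neq\emptyset$. By contrast, if $g:\mathbb{C}\to\mathbb{C}$ is a homeomorphism that is complex analytic, then $BU(g)=\emptyset$. -/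

import Mathlib

open MeasureTheory Filter
open scoped ContDiff ENNReal

/-- The escaping set `I(f)`: the points whose orbit tends to infinity. -/
def escapingSet {X : Type*} [Bornology X] (f : X → X) : Set X :=
  {x | Tendsto (fun n : ℕ => f^[n] x) atTop (Bornology.cobounded X)}

/-- The bounded orbit set `BO(f)`: the points whose orbit is bounded. -/
def boundedOrbitSet {X : Type*} [Bornology X] (f : X → X) : Set X :=
  {x | Bornology.IsBounded (Set.range fun n : ℕ => f^[n] x)}

/-- The bungee set `BU(f)`: the points that are neither in `I(f)` nor in `BO(f)`. -/
def bungeeSet {X : Type*} [Bornology X] (f : X → X) : Set X :=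
  (escapingSet f ∪ boundedOrbitSet f)ᶜ

/-- `G` is a weak (distributional) derivative of `f : ℝ^d → ℝ^d`: both are locally integrable and
`∫ (∂ᵥφ) f = - ∫ φ (G v)` for every direction `v` and every test function `φ ∈ C_c^∞(ℝ^d)`. -/
structure IsWeakFDeriv {d : ℕ} (f : EuclideanSpace ℝ (Fin d) → EuclideanSpace ℝ (Fin d))
    (G : EuclideanSpace ℝ (Fin d) → (EuclideanSpace ℝ (Fin d) →L[ℝ] EuclideanSpace ℝ (Fin d))) :
    Prop where
  locallyIntegrable : LocallyIntegrable f volume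
  locallyIntegrable_deriv : LocallyIntegrable G volume
  integral_eq : ∀ φ : EuclideanSpace ℝ (Fin d) → ℝ, ContDiff ℝ ∞ φ → HasCompactSupport φ →
    ∀ v : EuclideanSpace ℝ (Fin d),
      ∫ x, (fderiv ℝ φ x v) • f x = - ∫ x, φ x • G x v

/-- `f : ℝ^d → ℝ^d` is quasiregular: it is continuous, belongs to `W^{1,d}_loc`, and there is
`K ≥ 1` such that its weak derivative satisfies `|Df(x)|^d ≤ K J_f(x)` for almost every `x`, where
`|Df(x)|` is the Euclidean operator norm and `J_f(x) = det Df(x)`. -/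
def IsQuasiregularMap {d : ℕ} (f : EuclideanSpace ℝ (Fin d) → EuclideanSpace ℝ (Fin d)) : Prop :=
  Continuous f ∧
    ∃ G : EuclideanSpace ℝ (Fin d) → (EuclideanSpace ℝ (Fin d) →L[ℝ] EuclideanSpace ℝ (Fin d)),
      IsWeakFDeriv f G ∧
      (∀ C : Set (EuclideanSpace ℝ (Fin d)), IsCompact C →
        MemLp G (d : ℝ≥0∞) (volume.restrict C)) ∧
      ∃ K : ℝ, 1 ≤ K ∧ ∀ᵐ x, ‖G x‖ ^ d ≤ K * (G x).det

/-- A quasiconformal map `ℝ^d → ℝ^d` of the whole space: a homeomorphism of `ℝ^d` onto itself that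
is quasiregular. -/
def IsQuasiconformalMap {d : ℕ} (f : EuclideanSpace ℝ (Fin d) → EuclideanSpace ℝ (Fin d)) : Prop :=
  IsHomeomorph f ∧ IsQuasiregularMap f

/-! The quasiconformal example is a skew product over an irrational rotation, `rotationStretch`: on
unit vectors it acts as `u ↦ a * u`, and it multiplies moduli by `exp (h u)`. The orbit of `1` has
modulus the exponential of the Birkhoff sums of `h`, so a bungee point appears once these sums are
unbounded above yet bounded along a subsequence (`exists_rotation_birkhoffSum`). With `a` from a
Liouville number, `h` is a lacunary sum of coboundaries with no bounded total transfer function. It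
is Lipschitz, so the homogeneous map is bi-Lipschitz; its Jacobian is `exp (h u) ^ 2`, bounded
below, which gives quasiconformality.

An entire homeomorphism is proper, hence a polynomial; injectivity makes it affine, and affine
orbits are explicit. -/

/-! ### Entire homeomorphisms and affine dynamics. -/

open Topology in
/-- An entire function with no zero except possibly at the origin is a power of `z` times an entire
function without zeros. -/
theorem Differentiable.exists_eq_pow_mul_of_ne_zero {f : ℂ → ℂ} (hf : Differentiable ℂ f)
    (h0 : ∀ z, z ≠ 0 → f z ≠ 0) :
    ∃ (n : ℕ) (v : ℂ → ℂ), Differentiable ℂ v ∧ (∀ z, v z ≠ 0) ∧ ∀ z, f z = z ^ n * v z := by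
  obtain ⟨p, hp⟩ := hf.analyticAt 0
  have hpow : ∀ z, f z = z ^ p.order * (Function.swap dslope 0)^[p.order] f z := fun z => by
    simpa using hp.eq_pow_order_mul_iterate_dslope z
  have hp0 : p ≠ 0 := fun h => by
    have hz := hp.locally_zero_iff.2 h
    have hne : ∀ᶠ z in 𝓝[≠] (0 : ℂ), f z = 0 := hz.filter_mono nhdsWithin_le_nhds
    obtain ⟨z, hz1, hz2⟩ := (hne.and self_mem_nhdsWithin).exists
    exact h0 z hz2 hz1
  refine ⟨p.order, _, ?_, fun z => ?_, hpow⟩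
  · have : ∀ n : ℕ, Differentiable ℂ ((Function.swap dslope 0)^[n] f) := fun n => by
      induction n with
      | zero => exact hf
      | succ n ih =>
        rw [Function.iterate_succ_apply']
        exact differentiableOn_univ.1
          ((Complex.differentiableOn_dslope univ_mem).2 ih.differentiableOn)
    exact this _
  · by_cases hz : z = 0
    · rw [hz]; exact hp.iterate_dslope_fslope_ne_zero hp0
    · intro h
      exact h0 z hz (by rw [hpow, h, mul_zero])

open Topology in
/-- An entire function that vanishes only at the origin and tends to infinity at infinity is a
monomial. -/
theorem Differentiable.exists_eq_mul_pow_of_tendsto_cobounded {f : ℂ → ℂ}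
    (hf : Differentiable ℂ f) (h0 : ∀ z, z ≠ 0 → f z ≠ 0)
    (hinf : Tendsto f (Bornology.cobounded ℂ) (Bornology.cobounded ℂ)) :
    ∃ (n : ℕ) (c : ℂ), ∀ z, f z = c * z ^ n := by
  obtain ⟨k, v, hv, hv0, hfv⟩ := hf.exists_eq_pow_mul_of_ne_zero h0
  -- `F` is `f` read in the chart at infinity. Properness of `f` makes the value `0` at the origin
  -- continuous, so the singularity is removable.
  let F : ℂ → ℂ := Function.update (fun w => (f w⁻¹)⁻¹) 0 0
  have hFne : ∀ w, w ≠ 0 → F w = (f w⁻¹)⁻¹ := fun w hw => Function.update_of_ne hw _ _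
  have hFd : ∀ w, w ≠ 0 → DifferentiableAt ℂ F w := fun w hw => by
    have h1 : DifferentiableAt ℂ (fun w => (f w⁻¹)⁻¹) w :=
      ((hf w⁻¹).comp w (differentiableAt_inv hw)).inv (h0 _ (inv_ne_zero hw))
    refine h1.congr_of_eventuallyEq ?_
    filter_upwards [isOpen_ne.mem_nhds hw] with y hy using hFne y hy
  have hFc : ContinuousAt F 0 := by
    rw [continuousAt_update_same]
    exact tendsto_inv₀_cobounded.comp (hinf.comp tendsto_inv₀_nhdsNE_zero)
  have hF : Differentiable ℂ F := fun w => by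
    by_cases hw : w = 0
    · rw [hw]
      refine (Complex.analyticAt_of_differentiable_on_punctured_nhds_of_continuousAt ?_
        hFc).differentiableAt
      filter_upwards [self_mem_nhdsWithin] with y hy using hFd y hy
    · exact hFd w hw
  obtain ⟨m, u, hu, hu0, hFu⟩ := hF.exists_eq_pow_mul_of_ne_zero fun w hw => by
    rw [hFne w hw]; exact inv_ne_zero (h0 _ (inv_ne_zero hw))
  have key : ∀ z, z ≠ 0 → z ^ k * v z * u z⁻¹ = z ^ m := fun z hz => by
    have h1 := hFu z⁻¹
    rw [hFne _ (inv_ne_zero hz), inv_inv, hfv z] at h1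
    have hne : z ^ k * v z ≠ 0 := mul_ne_zero (pow_ne_zero _ hz) (hv0 z)
    have h2 : (1 : ℂ) = (z ^ k * v z) * ((z⁻¹) ^ m * u z⁻¹) := by
      rw [← h1, mul_inv_cancel₀ hne]
    calc z ^ k * v z * u z⁻¹ = z ^ m * ((z ^ k * v z) * ((z⁻¹) ^ m * u z⁻¹)) := by
          rw [inv_pow]; field_simp
      _ = z ^ m := by rw [← h2, mul_one]
  have hinv : Tendsto (fun z : ℂ => z⁻¹) (Bornology.cobounded ℂ) (𝓝 0) := tendsto_inv₀_cobounded
  have hu1 : Tendsto (fun z : ℂ => u z⁻¹) (Bornology.cobounded ℂ) (𝓝 (u 0)) :=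
    (hu.continuous.tendsto 0).comp hinv
  have hne0 : ∀ᶠ z : ℂ in Bornology.cobounded ℂ, z ≠ 0 :=
    Bornology.isBounded_def.1 (Bornology.isBounded_singleton (x := (0 : ℂ)))
  refine ⟨k, v 0, fun z => ?_⟩
  -- By `key`, `v` behaves at infinity like a constant times `z ^ (m - k)`. If `m ≤ k` then `v` has
  -- a finite limit and is constant by Liouville's theorem; otherwise `v⁻¹` tends to `0`, hence
  -- vanishes identically, which is absurd.
  rcases le_or_gt m k with hmk | hmk
  · have hlim : Tendsto v (cocompact ℂ) (𝓝 (0 ^ (k - m) * (u 0)⁻¹)) := by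
      rw [← Metric.cobounded_eq_cocompact]
      refine ((hinv.pow (k - m)).mul (hu1.inv₀ (hu0 0))).congr' ?_
      filter_upwards [hne0] with z hz
      have h := key z hz
      obtain ⟨j, rfl⟩ := Nat.exists_eq_add_of_le hmk
      have hu' := hu0 z⁻¹
      generalize u z⁻¹ = t at h hu' ⊢
      rw [Nat.add_sub_cancel_left, inv_pow]
      have hzm := pow_ne_zero m hz
      field_simp
      rw [pow_add] at h
      apply mul_left_cancel₀ hzm
      linear_combination -h
    rw [hfv, hv.apply_eq_of_tendsto_cocompact z hlim, hv.apply_eq_of_tendsto_cocompact 0 hlim,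
      mul_comm]
  · exfalso
    have hlim : Tendsto (fun z => (v z)⁻¹) (cocompact ℂ) (𝓝 (0 ^ (m - k) * u 0)) := by
      rw [← Metric.cobounded_eq_cocompact]
      refine ((hinv.pow (m - k)).mul hu1).congr' ?_
      filter_upwards [hne0] with z hz
      have h := key z hz
      obtain ⟨j, rfl⟩ := Nat.exists_eq_add_of_le hmk.le
      have hv' := hv0 z
      generalize u z⁻¹ = t at h ⊢
      rw [Nat.add_sub_cancel_left, inv_pow]
      have hzk := pow_ne_zero k hz
      field_simp
      rw [pow_add] at h
      apply mul_left_cancel₀ hzk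
      linear_combination h
    have h := (hv.inv hv0).apply_eq_of_tendsto_cocompact 0 hlim
    rw [zero_pow (by omega), zero_mul] at h
    exact inv_ne_zero (hv0 0) h

/-- An entire homeomorphism of the plane is affine. -/
theorem IsHomeomorph.exists_eq_affine {g : ℂ → ℂ} (hg : IsHomeomorph g)
    (hd : Differentiable ℂ g) : ∃ a b : ℂ, ∀ z, g z = a * z + b := by
  have hinf : Tendsto (fun z => g z - g 0) (Bornology.cobounded ℂ) (Bornology.cobounded ℂ) := by
    have h1 : Tendsto g (Bornology.cobounded ℂ) (Bornology.cobounded ℂ) := by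
      rw [Metric.cobounded_eq_cocompact]
      exact hg.isClosedEmbedding.tendsto_cocompact
    simpa [Function.comp_def, sub_eq_add_neg] using
      (tendsto_add_const_cobounded (-(g 0))).comp h1
  obtain ⟨n, c, hc⟩ := (hd.sub_const (g 0)).exists_eq_mul_pow_of_tendsto_cobounded
    (fun z hz => sub_ne_zero.2 (hg.injective.ne hz)) hinf
  have hval : ∀ z, g z = c * z ^ n + g 0 := fun z => by rw [← hc z]; ring
  have hn0 : n ≠ 0 := fun h => by
    have h1 := hval 1
    have h2 := hval 0
    rw [h] at h1 h2
    exact one_ne_zero (hg.injective (by rw [h1]; exact h2.symm))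
  -- A primitive `n`-th root of unity has the same image as `1`.
  have hone : Complex.exp (2 * Real.pi * Complex.I / n) = 1 := hg.injective <| by
    rw [hval, (Complex.isPrimitiveRoot_exp n hn0).pow_eq_one, hval 1, one_pow]
  have hn1 : n = 1 := (Complex.isPrimitiveRoot_exp n hn0).unique
    (hone ▸ IsPrimitiveRoot.one)
  exact ⟨c, g 0, fun z => by rw [hval, hn1, pow_one]⟩

/-- Either `g` is a translation, or it is multiplication by `a` about the fixed point `b / (1 - a)`;
in both cases each orbit is bounded or escapes. -/
theorem bungeeSet_eq_empty_of_affine {g : ℂ → ℂ} {a b : ℂ} (hg : ∀ z, g z = a * z + b) :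
    bungeeSet g = ∅ := by
  refine Set.compl_empty_iff.2 (Set.eq_univ_of_forall fun z => ?_)
  by_cases ha : a = 1
  · have hit : ∀ n : ℕ, g^[n] z = z + n * b := fun n => by
      induction n with
      | zero => simp
      | succ n ih => rw [Function.iterate_succ_apply', ih, hg, ha]; push_cast; ring
    by_cases hb : b = 0
    · right
      refine (Bornology.isBounded_singleton (x := z)).subset ?_
      rintro _ ⟨n, rfl⟩
      simp [hit, hb]
    · left
      refine tendsto_norm_atTop_iff_cobounded.1 ?_
      have h1 : Tendsto (fun n : ℕ => (n : ℝ) * ‖b‖ - ‖z‖) atTop atTop :=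
        tendsto_atTop_add_const_right _ _
          (tendsto_natCast_atTop_atTop.atTop_mul_const (norm_pos_iff.2 hb))
      refine tendsto_atTop_mono (fun n => ?_) h1
      rw [hit]
      have := norm_sub_le (z + n * b) z
      rw [add_sub_cancel_left, norm_mul, Complex.norm_natCast] at this
      linarith
  · set p : ℂ := b / (1 - a) with hp
    have h1a : 1 - a ≠ 0 := sub_ne_zero.2 (Ne.symm ha)
    have hfix : a * p + b = p := by rw [hp]; field_simp; ring
    have hit : ∀ n : ℕ, g^[n] z = p + a ^ n * (z - p) := fun n => by
      induction n with
      | zero => simp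
      | succ n ih =>
        rw [Function.iterate_succ_apply', ih, hg]; linear_combination hfix
    rcases le_or_gt ‖a‖ 1 with h | h
    · right
      refine (isBounded_iff_forall_norm_le (E := ℂ)).2 ⟨‖p‖ + ‖z - p‖, ?_⟩
      rintro _ ⟨n, rfl⟩
      simp only [hit]
      refine (norm_add_le _ _).trans (add_le_add le_rfl ?_)
      rw [norm_mul, norm_pow]
      exact mul_le_of_le_one_left (norm_nonneg _) (pow_le_one₀ (norm_nonneg _) h)
    · by_cases hz : z = p
      · right
        refine (Bornology.isBounded_singleton (x := p)).subset ?_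
        rintro _ ⟨n, rfl⟩
        simp only [hit, sub_eq_zero.2 hz, mul_zero, add_zero, Set.mem_singleton_iff]
      · left
        refine tendsto_norm_atTop_iff_cobounded.1 ?_
        have h1 : Tendsto (fun n : ℕ => ‖a‖ ^ n * ‖z - p‖ - ‖p‖) atTop atTop :=
          tendsto_atTop_add_const_right _ _
            ((tendsto_pow_atTop_atTop_of_one_lt h).atTop_mul_const
              (norm_pos_iff.2 (sub_ne_zero.2 hz)))
        refine tendsto_atTop_mono (fun n => ?_) h1
        rw [hit]
        have := norm_sub_le (p + a ^ n * (z - p)) p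
        rw [add_sub_cancel_left, norm_mul, norm_pow] at this
        linarith

/-! ### Liouville rotations and Birkhoff sums. -/

theorem norm_pow_sub_pow_le_of_norm_le_one {z w : ℂ} (hz : ‖z‖ ≤ 1) (hw : ‖w‖ ≤ 1) (n : ℕ) :
    ‖z ^ n - w ^ n‖ ≤ n * ‖z - w‖ := by
  induction n with
  | zero => simp
  | succ n ih =>
    have h1 : z ^ (n + 1) - w ^ (n + 1) = z ^ n * (z - w) + (z ^ n - w ^ n) * w := by ring
    have h2 : ‖z ^ n * (z - w)‖ ≤ ‖z - w‖ := by
      rw [norm_mul, norm_pow]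
      exact mul_le_of_le_one_left (norm_nonneg _) (pow_le_one₀ (norm_nonneg _) hz)
    have h3 : ‖(z ^ n - w ^ n) * w‖ ≤ n * ‖z - w‖ := by
      rw [norm_mul]
      exact (mul_le_of_le_one_right (norm_nonneg _) hw).trans ih
    rw [h1]
    refine (norm_add_le _ _).trans ?_
    push_cast
    linarith

/-- A rotation of the circle with very good rational approximations, at the denominators `Q k`. -/
theorem exists_rotation_of_liouville :
    ∃ (a : ℂ) (Q : ℕ → ℕ), ‖a‖ = 1 ∧ StrictMono Q ∧ (∀ k, 1 ≤ Q k) ∧ (∀ k, a ^ Q k ≠ 1) ∧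
      ∀ k, Q k * ‖1 - a ^ Q k‖ ≤ Real.pi * (1 / 2) ^ k := by
  obtain ⟨α, hα⟩ : ∃ α : ℝ, Liouville α := ⟨_, liouville_liouvilleNumber le_rfl⟩
  -- Of the exponent `k + 3`, one power of `Q k` is lost in passing from `α - m / Q k` to `Q k * α -
  -- m` and one to the weight `Q k`; the rest is at most `(1 / 2) ^ (k + 1)` since `2 ≤ Q k`.
  obtain ⟨Q, hQm, hQ⟩ := extraction_forall_of_frequently fun k =>
    (hα.frequently_exists_num (k + 3)).and_eventually (eventually_ge_atTop 2)
  have hpow : ∀ (k : ℕ), Complex.exp (Complex.I * (2 * Real.pi * α : ℝ)) ^ Q k =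
      Complex.exp (Complex.I * (2 * Real.pi * (Q k * α) : ℝ)) := fun k => by
    rw [← Complex.exp_nat_mul]
    congr 1
    push_cast
    ring
  refine ⟨Complex.exp (Complex.I * (2 * Real.pi * α : ℝ)), Q, ?_, hQm,
    fun k => by have := (hQ k).2; omega, fun k h => ?_, fun k => ?_⟩
  · rw [mul_comm]; exact Complex.norm_exp_ofReal_mul_I _
  · rw [hpow, Complex.exp_eq_one_iff] at h
    obtain ⟨n, hn⟩ := h
    have h1 : ((Q k * α : ℝ) : ℂ) = ((n : ℝ) : ℂ) := by
      have hpi : (2 * Real.pi * Complex.I : ℂ) ≠ 0 := Complex.two_pi_I_ne_zero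
      apply mul_right_cancel₀ hpi
      push_cast at hn ⊢
      linear_combination hn
    have h2 : (Q k * α : ℝ) = n := by exact_mod_cast h1
    have hQ0 : Q k ≠ 0 := by have := (hQ k).2; omega
    exact (hα.irrational.natCast_mul hQ0).ne_int n h2
  · obtain ⟨⟨m, -, hm⟩, hk2⟩ := hQ k
    have hQ2 : (2 : ℝ) ≤ Q k := by exact_mod_cast hk2
    have hQ0 : (0 : ℝ) < Q k := by linarith
    have hexp : Complex.exp (Complex.I * (2 * Real.pi * (Q k * α) : ℝ)) =
        Complex.exp (Complex.I * (2 * Real.pi * (Q k * α - m) : ℝ)) := by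
      rw [Complex.exp_eq_exp_iff_exists_int]
      exact ⟨m, by push_cast; ring⟩
    have h1 : ‖1 - Complex.exp (Complex.I * (2 * Real.pi * α : ℝ)) ^ Q k‖ ≤
        2 * Real.pi * |Q k * α - m| := by
      rw [hpow, hexp, norm_sub_rev]
      refine Real.norm_exp_I_mul_ofReal_sub_one_le.trans_eq ?_
      rw [Real.norm_eq_abs, abs_mul, abs_of_pos Real.two_pi_pos]
    have h2 : |Q k * α - m| ≤ Q k * (1 / (Q k : ℝ) ^ (k + 3)) := by
      have : (Q k : ℝ) * α - m = Q k * (α - m / Q k) := by field_simp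
      rw [this, abs_mul, abs_of_pos hQ0]
      exact mul_le_mul_of_nonneg_left hm.le hQ0.le
    have h3 : (Q k : ℝ) * (Q k * (1 / (Q k : ℝ) ^ (k + 3))) = (1 / (Q k : ℝ)) ^ (k + 1) := by
      rw [one_div_pow]; field_simp; ring
    have h4 : (1 / (Q k : ℝ)) ^ (k + 1) ≤ (1 / 2) ^ (k + 1) := by
      gcongr
    calc (Q k : ℝ) * ‖1 - Complex.exp (Complex.I * (2 * Real.pi * α : ℝ)) ^ Q k‖
        ≤ Q k * (2 * Real.pi * (Q k * (1 / (Q k : ℝ) ^ (k + 3)))) := by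
          refine mul_le_mul_of_nonneg_left (h1.trans ?_) hQ0.le
          exact mul_le_mul_of_nonneg_left h2 Real.two_pi_pos.le
      _ = 2 * Real.pi * (1 / (Q k : ℝ)) ^ (k + 1) := by rw [← h3]; ring
      _ ≤ 2 * Real.pi * (1 / 2) ^ (k + 1) := mul_le_mul_of_nonneg_left h4 Real.two_pi_pos.le
      _ = Real.pi * (1 / 2) ^ k := by rw [pow_succ]; ring

/-- There are an irrational rotation `u ↦ a * u` and a Lipschitz function `h` on the disc whose
Birkhoff sums along the orbit of `1` are unbounded above but return to a bounded set. -/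
theorem exists_rotation_birkhoffSum :
    ∃ (a : ℂ) (h : ℂ → ℝ) (M : ℝ), ‖a‖ = 1 ∧
      (∀ u, ‖u‖ ≤ 1 → |h u| ≤ M) ∧
      (∀ u v, ‖u‖ ≤ 1 → ‖v‖ ≤ 1 → |h u - h v| ≤ M * ‖u - v‖) ∧
      (∃ B, ∃ᶠ n in atTop, ∑ j ∈ Finset.range n, h (a ^ j) ≤ B) ∧
      ∀ B, ∃ n, B < ∑ j ∈ Finset.range n, h (a ^ j) := by
  obtain ⟨a, Q, ha, hQm, hQ1, hne, hc⟩ := exists_rotation_of_liouville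
  set c : ℕ → ℝ := fun k => Real.pi * (1 / 2) ^ k with hcdef
  have hcs : Summable c := (summable_geometric_of_lt_one (by norm_num) (by norm_num)).mul_left _
  have hanti : Antitone c := fun i j hij => mul_le_mul_of_nonneg_left
    (pow_le_pow_of_le_one (by norm_num) (by norm_num) hij) Real.pi_pos.le
  have hpow1 : ∀ n, ‖a ^ n‖ ≤ 1 := fun n => by rw [norm_pow, ha, one_pow]
  have hd : ∀ k, ‖1 - a ^ Q k‖ ≤ c k := fun k => by
    refine le_trans ?_ (hc k)
    exact le_mul_of_one_le_left (norm_nonneg _) (by exact_mod_cast hQ1 k)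
  -- `t k` is the coboundary of `z ↦ (z ^ Q k).re`, so its Birkhoff sums telescope to `S n k ≥ 0`.
  -- The weight `Q k` in `hc` pays for the Lipschitz constant of `z ^ Q k`.
  let t : ℕ → ℂ → ℝ := fun k z => ((1 - a ^ Q k) * z ^ Q k).re
  have ht : ∀ k u, ‖u‖ ≤ 1 → |t k u| ≤ c k := fun k u hu => by
    refine (Complex.abs_re_le_norm _).trans ?_
    rw [norm_mul, norm_pow]
    exact (mul_le_of_le_one_right (norm_nonneg _) (pow_le_one₀ (norm_nonneg _) hu)).trans (hd k)
  have hts : ∀ u, ‖u‖ ≤ 1 → Summable fun k => t k u := fun u hu =>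
    Summable.of_norm_bounded hcs fun k => ht k u hu
  let S : ℕ → ℕ → ℝ := fun n k => 1 - (a ^ (n * Q k)).re
  have hS : ∀ n, HasSum (S n) (∑ j ∈ Finset.range n, ∑' k, t k (a ^ j)) := fun n => by
    have h1 : HasSum (fun k => ∑ j ∈ Finset.range n, t k (a ^ j))
        (∑ j ∈ Finset.range n, ∑' k, t k (a ^ j)) :=
      hasSum_sum fun j _ => (hts _ (hpow1 j)).hasSum
    convert h1 using 2 with k
    have h2 : ∀ j, t k (a ^ j) = (a ^ (j * Q k)).re - (a ^ ((j + 1) * Q k)).re := fun j => by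
      rw [← Complex.sub_re]
      simp only [t]
      congr 1
      ring
    simp only [h2, Finset.sum_range_sub', S]
    simp
  have hS0 : ∀ n k, 0 ≤ S n k := fun n k =>
    sub_nonneg.2 ((Complex.re_le_norm _).trans (hpow1 _))
  refine ⟨a, fun u => ∑' k, t k u, ∑' k, c k, ha, fun u hu => ?_, fun u v hu hv => ?_,
    ⟨∑' k, c k, ?_⟩, fun B => ?_⟩
  · exact tsum_of_norm_bounded (f := fun k => t k u) hcs.hasSum fun k => ht k u hu
  · rw [← (hts u hu).tsum_sub (hts v hv)]
    refine tsum_of_norm_bounded (f := fun k => t k u - t k v) (hcs.hasSum.mul_right ‖u - v‖)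
      fun k => ?_
    rw [← Complex.sub_re, ← mul_sub, Real.norm_eq_abs]
    refine (Complex.abs_re_le_norm _).trans ?_
    rw [norm_mul]
    calc ‖1 - a ^ Q k‖ * ‖u ^ Q k - v ^ Q k‖ ≤ ‖1 - a ^ Q k‖ * (Q k * ‖u - v‖) :=
          mul_le_mul_of_nonneg_left (norm_pow_sub_pow_le_of_norm_le_one hu hv _) (norm_nonneg _)
      _ = (Q k * ‖1 - a ^ Q k‖) * ‖u - v‖ := by ring
      _ ≤ c k * ‖u - v‖ := mul_le_mul_of_nonneg_right (hc k) (norm_nonneg _)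
  -- The times `Q N` are good returns. The exponent `Q N * Q k` is symmetric, so `S (Q N) k` is
  -- estimated from the better approximation, that of the larger index; the other denominator is
  -- absorbed by the weight in `hc`.
  · refine frequently_atTop.2 fun N => ⟨Q N, hQm.id_le N, ?_⟩
    refine hasSum_le (fun k => ?_) (hS (Q N)) hcs.hasSum
    have h1 : S (Q N) k ≤ ‖1 - a ^ (Q N * Q k)‖ := by
      have := Complex.re_le_norm (1 - a ^ (Q N * Q k))
      simpa [S] using this
    have h2 : ∀ i j : ℕ, ‖1 - a ^ (i * j)‖ ≤ j * ‖1 - a ^ i‖ := fun i j => by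
      have := norm_pow_sub_pow_le_of_norm_le_one (z := 1) (by simp) (hpow1 i) j
      rwa [one_pow, ← pow_mul] at this
    refine h1.trans ?_
    rcases lt_or_ge k N with hk | hk
    · refine (h2 _ _).trans (le_trans ?_ ((hc N).trans (hanti hk.le)))
      exact mul_le_mul_of_nonneg_right (by exact_mod_cast hQm.monotone hk.le) (norm_nonneg _)
    · rw [mul_comm (Q N)]
      refine (h2 _ _).trans (le_trans ?_ (hc k))
      exact mul_le_mul_of_nonneg_right (by exact_mod_cast hQm.monotone hk) (norm_nonneg _)
  -- For fixed `k`, the time average of `S n k` tends to `1`, because the geometric sums of `a ^ Q k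
  -- ≠ 1` stay bounded. The first `K` terms thus average to about `K > B + 1`, against the bound
  -- `B`.
  · by_contra! hB
    obtain ⟨K, hK⟩ := exists_nat_gt (B + 1)
    set D : ℝ := ∑ k ∈ Finset.range K, 2 / ‖1 - a ^ Q k‖ with hD
    have hgeom : ∀ N k, ∑ n ∈ Finset.range N, (a ^ (n * Q k)).re ≤ 2 / ‖1 - a ^ Q k‖ :=
      fun N k => by
        have h0 : 0 < ‖1 - a ^ Q k‖ := norm_pos_iff.2 (sub_ne_zero.2 (hne k).symm)
        have h1 := mul_neg_geom_sum (a ^ Q k) N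
        rw [le_div_iff₀ h0, ← Complex.re_sum]
        refine (mul_le_mul_of_nonneg_right (Complex.re_le_norm _) h0.le).trans ?_
        have h2 : ∑ n ∈ Finset.range N, a ^ (n * Q k) =
            ∑ n ∈ Finset.range N, (a ^ Q k) ^ n :=
          Finset.sum_congr rfl fun n _ => by rw [mul_comm, pow_mul]
        rw [← norm_mul, h2, mul_comm, h1]
        refine (norm_sub_le _ _).trans ?_
        rw [norm_one, ← pow_mul]
        linarith [hpow1 (Q k * N)]
    have hbound : ∀ N : ℕ, (N : ℝ) ≤ D := fun N => by
      have h1 : ∑ n ∈ Finset.range N, ∑ k ∈ Finset.range K, S n k ≤ N * B := by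
        have : ∀ n ∈ Finset.range N, ∑ k ∈ Finset.range K, S n k ≤ B := fun n _ =>
          (sum_le_hasSum _ (fun k _ => hS0 n k) (hS n)).trans (hB n)
        simpa using Finset.sum_le_card_nsmul _ _ _ this
      rw [Finset.sum_comm] at h1
      have h2 : ∑ k ∈ Finset.range K, ((N : ℝ) - 2 / ‖1 - a ^ Q k‖) ≤
          ∑ k ∈ Finset.range K, ∑ n ∈ Finset.range N, S n k :=
        Finset.sum_le_sum fun k _ => by
          simp only [S, Finset.sum_sub_distrib, Finset.sum_const, Finset.card_range, nsmul_eq_mul,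
            mul_one]
          linarith [hgeom N k]
      rw [Finset.sum_sub_distrib, ← hD, Finset.sum_const, Finset.card_range, nsmul_eq_mul] at h2
      have hN : (0 : ℝ) ≤ N := N.cast_nonneg
      nlinarith
    obtain ⟨N, hN⟩ := exists_nat_gt D
    exact absurd (hbound N) (not_le.2 hN)

/-! ### Lipschitz maps and weak derivatives. -/

open Topology in
/-- The classical derivative of a Lipschitz map is its weak derivative. -/
theorem LipschitzWith.isWeakFDeriv {d : ℕ}
    {f : EuclideanSpace ℝ (Fin d) → EuclideanSpace ℝ (Fin d)} {C : NNReal}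
    (hf : LipschitzWith C f) : IsWeakFDeriv f (fderiv ℝ f) where
  locallyIntegrable := hf.continuous.locallyIntegrable
  locallyIntegrable_deriv := by
    refine (locallyIntegrable_const (C : ℝ)).mono
      (measurable_fderiv ℝ f).aestronglyMeasurable (ae_of_all _ fun x => ?_)
    simpa using norm_fderiv_le_of_lipschitz ℝ hf
  integral_eq φ hφ hφc v := by
    have hdφ : Continuous fun x => fderiv ℝ φ x v :=
      (hφ.continuous_fderiv (by simp)).clm_apply continuous_const
    have hint1 : Integrable fun x => (fderiv ℝ φ x v) • f x :=
      (hdφ.smul hf.continuous).integrable_of_hasCompactSupport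
        ((hφc.fderiv_apply ℝ v).smul_right)
    have hint2 : Integrable fun x => φ x • fderiv ℝ f x v := by
      refine ((hφ.continuous.integrable_of_hasCompactSupport hφc).norm.mul_const
        (C * ‖v‖)).mono ?_ (ae_of_all _ fun x => ?_)
      · exact hφ.continuous.aestronglyMeasurable.smul
          (measurable_fderiv_apply_const ℝ f v).aestronglyMeasurable
      · rw [norm_smul, norm_mul, norm_norm]
        refine mul_le_mul_of_nonneg_left ?_ (norm_nonneg _)
        refine ((fderiv ℝ f x).le_opNorm v).trans (le_trans ?_ (le_abs_self _))
        exact mul_le_mul_of_nonneg_right (norm_fderiv_le_of_lipschitz ℝ hf) (norm_nonneg _)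
    -- Integration by parts for Lipschitz functions is scalar, so it is applied to each coordinate.
    ext i
    let p : EuclideanSpace ℝ (Fin d) →L[ℝ] ℝ := EuclideanSpace.proj i
    change p (∫ x, (fderiv ℝ φ x v) • f x) = p (-∫ x, φ x • fderiv ℝ f x v)
    rw [map_neg, ← p.integral_comp_comm hint1, ← p.integral_comp_comm hint2]
    have hpf : LipschitzWith (‖p‖₊ * C) fun x => p (f x) := p.lipschitz.comp hf
    obtain ⟨D, hD⟩ := (hφ.of_le (by simp) : ContDiff ℝ 1 φ).lipschitzWith_of_hasCompactSupport
      hφc one_ne_zero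
    have h := hpf.integral_lineDeriv_mul_eq (μ := volume) hD hφc v
    have h1 : ∫ x, p (φ x • fderiv ℝ f x v) = ∫ x, lineDeriv ℝ (fun x => p (f x)) x v * φ x := by
      refine integral_congr_ae ?_
      filter_upwards [hf.ae_differentiableAt] with x hx
      have := (p.hasFDerivAt.comp x hx.hasFDerivAt).hasLineDerivAt v
      rw [map_smul, smul_eq_mul, mul_comm]
      congr 1
      exact this.lineDeriv.symm
    have h2 : ∫ x, p ((fderiv ℝ φ x v) • f x) = - ∫ x, lineDeriv ℝ φ x (-v) * p (f x) := by
      rw [← integral_neg]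
      refine integral_congr_ae (ae_of_all _ fun x => ?_)
      have := (hφ.differentiable (by simp) x).lineDeriv_eq_fderiv (v := -v)
      simp only [this, map_neg, map_smul, smul_eq_mul, neg_mul, neg_neg]
    rw [h1, h2, h]

/-- A Lipschitz map whose Jacobian is bounded below by a positive constant is quasiregular. -/
theorem LipschitzWith.isQuasiregularMap {d : ℕ}
    {f : EuclideanSpace ℝ (Fin d) → EuclideanSpace ℝ (Fin d)} {C : NNReal}
    (hf : LipschitzWith C f) {δ : ℝ} (hδ : 0 < δ) (hdet : ∀ᵐ x, δ ≤ (fderiv ℝ f x).det) :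
    IsQuasiregularMap f := by
  refine ⟨hf.continuous, fderiv ℝ f, hf.isWeakFDeriv, fun s hs => ?_, max 1 (C ^ d / δ),
    le_max_left _ _, ?_⟩
  · have : IsFiniteMeasure (volume.restrict s) := ⟨by simpa using hs.measure_lt_top⟩
    exact MemLp.of_bound (measurable_fderiv ℝ f).aestronglyMeasurable C
      (ae_of_all _ fun x => norm_fderiv_le_of_lipschitz ℝ hf)
  · filter_upwards [hdet] with x hx
    calc ‖fderiv ℝ f x‖ ^ d ≤ C ^ d :=
          pow_le_pow_left₀ (norm_nonneg _) (norm_fderiv_le_of_lipschitz ℝ hf) d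
      _ = C ^ d / δ * δ := by field_simp
      _ ≤ max 1 (C ^ d / δ) * (fderiv ℝ f x).det :=
          mul_le_mul (le_max_right _ _) hx hδ.le (le_max_of_le_left zero_le_one)

/-! ### Geometry of the rotation-stretch map. -/

/-- The positively homogeneous map of the plane that rotates by `a` and stretches the ray through
the unit vector `u` by `exp (h u)`. -/
noncomputable def rotationStretch (a : ℂ) (h : ℂ → ℝ) (z : ℂ) : ℂ :=
  a * (Real.exp (h (z / ‖z‖)) * z)

theorem norm_div_norm_le_one (z : ℂ) : ‖z / ‖z‖‖ ≤ 1 := by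
  rw [norm_div, Complex.norm_real, norm_norm]
  exact div_self_le_one _

/-- Radial projection is not Lipschitz near the origin; the factor `‖w‖` compensates, exactly as the
factor `w` does in the stretch. -/
theorem norm_mul_norm_div_norm_sub_le (z w : ℂ) :
    ‖w‖ * ‖z / ‖z‖ - w / ‖w‖‖ ≤ 2 * ‖z - w‖ := by
  have hz : ∀ z : ℂ, (‖z‖ : ℂ) * (z / ‖z‖) = z := fun z => by
    by_cases h : z = 0
    · simp [h]
    · have : (‖z‖ : ℂ) ≠ 0 := by simpa using h
      field_simp
  have h1 : (‖w‖ : ℂ) * (z / ‖z‖ - w / ‖w‖) = ((‖w‖ - ‖z‖ : ℝ) : ℂ) * (z / ‖z‖) + (z - w) := by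
    push_cast
    linear_combination hz z - hz w
  calc ‖w‖ * ‖z / ‖z‖ - w / ‖w‖‖ = ‖(‖w‖ : ℂ) * (z / ‖z‖ - w / ‖w‖)‖ := by simp
    _ ≤ ‖((‖w‖ - ‖z‖ : ℝ) : ℂ) * (z / ‖z‖)‖ + ‖z - w‖ := by rw [h1]; exact norm_add_le _ _
    _ ≤ ‖z - w‖ + ‖z - w‖ := by
        refine add_le_add ?_ le_rfl
        rw [norm_mul, Complex.norm_real, Real.norm_eq_abs]
        refine (mul_le_of_le_one_right (abs_nonneg _) (norm_div_norm_le_one z)).trans ?_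
        rw [norm_sub_rev z]
        exact abs_norm_sub_norm_le w z
    _ = 2 * ‖z - w‖ := by ring

theorem Real.abs_exp_sub_exp_le {x y M : ℝ} (hx : x ≤ M) (hy : y ≤ M) :
    |Real.exp x - Real.exp y| ≤ Real.exp M * |x - y| := by
  wlog hxy : y ≤ x generalizing x y
  · rw [abs_sub_comm, abs_sub_comm x]
    exact this hy hx (le_of_not_ge hxy)
  rw [abs_of_nonneg (sub_nonneg.2 (Real.exp_le_exp.2 hxy)), abs_of_nonneg (sub_nonneg.2 hxy)]
  have h1 : Real.exp y = Real.exp x * Real.exp (y - x) := by rw [← Real.exp_add]; ring_nf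
  calc Real.exp x - Real.exp y = Real.exp x * (1 - Real.exp (y - x)) := by rw [h1]; ring
    _ ≤ Real.exp x * (x - y) :=
        mul_le_mul_of_nonneg_left (by linarith [Real.add_one_le_exp (y - x)]) (Real.exp_pos _).le
    _ ≤ Real.exp M * (x - y) :=
        mul_le_mul_of_nonneg_right (Real.exp_le_exp.2 hx) (sub_nonneg.2 hxy)

section

variable {a : ℂ} {h : ℂ → ℝ} {M : ℝ}

theorem rotationStretch_lipschitz (ha : ‖a‖ = 1) (hM : ∀ u, ‖u‖ ≤ 1 → |h u| ≤ M)
    (hL : ∀ u v, ‖u‖ ≤ 1 → ‖v‖ ≤ 1 → |h u - h v| ≤ M * ‖u - v‖) :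
    LipschitzWith (Real.exp M * (1 + 2 * M)).toNNReal (rotationStretch a h) := by
  have hM0 : 0 ≤ M := (abs_nonneg _).trans (hM 0 (by simp))
  refine LipschitzWith.of_dist_le_mul fun z w => ?_
  rw [Real.coe_toNNReal _ (by positivity), dist_eq_norm, dist_eq_norm]
  set u := z / (‖z‖ : ℂ) with hu
  set v := w / (‖w‖ : ℂ) with hv
  have hu1 : ‖u‖ ≤ 1 := norm_div_norm_le_one z
  have hv1 : ‖v‖ ≤ 1 := norm_div_norm_le_one w
  have h1 : rotationStretch a h z - rotationStretch a h w =
      a * (Real.exp (h u) * (z - w) + ((Real.exp (h u) - Real.exp (h v) : ℝ) : ℂ) * w) := by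
    simp only [rotationStretch, ← hu, ← hv]
    push_cast
    ring
  have h2 : |Real.exp (h u) - Real.exp (h v)| ≤ Real.exp M * (M * ‖u - v‖) :=
    (Real.abs_exp_sub_exp_le ((le_abs_self _).trans (hM u hu1))
      ((le_abs_self _).trans (hM v hv1))).trans
        (mul_le_mul_of_nonneg_left (hL u v hu1 hv1) (Real.exp_pos _).le)
  have h3 : Real.exp (h u) ≤ Real.exp M := Real.exp_le_exp.2 ((le_abs_self _).trans (hM u hu1))
  rw [h1, norm_mul, ha, one_mul]
  refine (norm_add_le _ _).trans ?_
  rw [norm_mul, norm_mul, Complex.norm_real, Complex.norm_real, Real.norm_eq_abs, Real.norm_eq_abs,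
    abs_of_pos (Real.exp_pos _)]
  calc Real.exp (h u) * ‖z - w‖ + |Real.exp (h u) - Real.exp (h v)| * ‖w‖
      ≤ Real.exp M * ‖z - w‖ + Real.exp M * (M * ‖u - v‖) * ‖w‖ := by gcongr
    _ = Real.exp M * (‖z - w‖ + M * (‖w‖ * ‖u - v‖)) := by ring
    _ ≤ Real.exp M * (‖z - w‖ + M * (2 * ‖z - w‖)) := by
        have := mul_le_mul_of_nonneg_left (norm_mul_norm_div_norm_sub_le z w) hM0
        gcongr
    _ = Real.exp M * (1 + 2 * M) * ‖z - w‖ := by ring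

theorem rotationStretch_div_norm (ha : ‖a‖ = 1) (z : ℂ) :
    rotationStretch a h z / ‖rotationStretch a h z‖ = a * (z / ‖z‖) := by
  have he : (Real.exp (h (z / ‖z‖)) : ℂ) ≠ 0 := by exact_mod_cast (Real.exp_pos _).ne'
  rw [rotationStretch, norm_mul, ha, one_mul, norm_mul, Complex.norm_real, Real.norm_eq_abs,
    abs_of_pos (Real.exp_pos _), Complex.ofReal_mul, mul_div_assoc, mul_div_mul_left _ _ he]

/-- The inverse belongs to the same family: the image of direction `u` has direction `a * u`, so the
stretch to undo is read at `a⁻¹` times the new direction. -/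
theorem rotationStretch_inv_rotationStretch (ha : ‖a‖ = 1) (z : ℂ) :
    rotationStretch a⁻¹ (fun u => -h (a⁻¹ * u)) (rotationStretch a h z) = z := by
  have ha0 : a ≠ 0 := fun h0 => by simp [h0] at ha
  have he : (Real.exp (h (z / ‖z‖)) : ℂ) ≠ 0 := by exact_mod_cast (Real.exp_pos _).ne'
  rw [rotationStretch, rotationStretch_div_norm ha, inv_mul_cancel_left₀ ha0, Real.exp_neg,
    Complex.ofReal_inv, rotationStretch]
  field_simp

theorem rotationStretch_isHomeomorph (ha : ‖a‖ = 1) (hM : ∀ u, ‖u‖ ≤ 1 → |h u| ≤ M)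
    (hL : ∀ u v, ‖u‖ ≤ 1 → ‖v‖ ≤ 1 → |h u - h v| ≤ M * ‖u - v‖) :
    IsHomeomorph (rotationStretch a h) := by
  have ha0 : a ≠ 0 := fun h0 => by simp [h0] at ha
  have hai : ‖a⁻¹‖ = 1 := by rw [norm_inv, ha, inv_one]
  have hmul : ∀ u, ‖u‖ ≤ 1 → ‖a⁻¹ * u‖ ≤ 1 := fun u hu => by rwa [norm_mul, hai, one_mul]
  have hinv := rotationStretch_lipschitz (h := fun u => -h (a⁻¹ * u)) (M := M) hai
    (fun u hu => by rw [abs_neg]; exact hM _ (hmul u hu))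
    (fun u v hu hv => by
      have := hL _ _ (hmul u hu) (hmul v hv)
      rw [← mul_sub, norm_mul, hai, one_mul] at this
      rwa [neg_sub_neg, abs_sub_comm])
  let e : ℂ ≃ₜ ℂ :=
    { toFun := rotationStretch a h
      invFun := rotationStretch a⁻¹ fun u => -h (a⁻¹ * u)
      left_inv := rotationStretch_inv_rotationStretch ha
      right_inv := fun z => by
        have := rotationStretch_inv_rotationStretch (h := fun u => -h (a⁻¹ * u)) hai z
        simpa only [inv_inv, neg_neg, inv_mul_cancel_left₀ ha0] using this
      continuous_toFun := (rotationStretch_lipschitz ha hM hL).continuous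
      continuous_invFun := hinv.continuous }
  exact e.isHomeomorph

theorem Complex.det_eq_of_real_linear (L : ℂ →L[ℝ] ℂ) :
    L.det = (L 1).re * (L Complex.I).im - (L Complex.I).re * (L 1).im := by
  rw [ContinuousLinearMap.det, ← LinearMap.det_toMatrix Complex.basisOneI, Matrix.det_fin_two]
  simp [LinearMap.toMatrix_apply]

open Topology in
-- The stretch factor `E` is constant on rays, so its derivative `l` kills `z`. Up to the rotation
-- the differential is `E z` times the identity plus the rank-one map `l.smulRight z`, whose trace
-- `l z` is zero.
theorem rotationStretch_det_fderiv (ha : ‖a‖ = 1) {z : ℂ} (hz : z ≠ 0)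
    (hd : DifferentiableAt ℝ (rotationStretch a h) z) :
    (fderiv ℝ (rotationStretch a h) z).det = Real.exp (h (z / ‖z‖)) ^ 2 := by
  let E : ℂ → ℝ := fun w => Real.exp (h (w / ‖w‖))
  have hn : ∀ w, ‖rotationStretch a h w‖ = E w * ‖w‖ := fun w => by
    rw [rotationStretch, norm_mul, ha, one_mul, norm_mul, Complex.norm_real, Real.norm_eq_abs,
      abs_of_pos (Real.exp_pos _)]
  -- No smoothness of `h` is assumed; `E` is recovered as a quotient of norms.
  have hEd : DifferentiableAt ℝ E z := by
    have h0 : rotationStretch a h z ≠ 0 := by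
      rw [← norm_ne_zero_iff, hn]
      exact mul_ne_zero (Real.exp_pos _).ne' (norm_ne_zero_iff.2 hz)
    have h1 : DifferentiableAt ℝ (fun w => ‖rotationStretch a h w‖ * ‖w‖⁻¹) z :=
      (hd.norm ℝ h0).fun_mul ((differentiableAt_inv (norm_ne_zero_iff.2 hz)).fun_comp' z
        (differentiableAt_fun_id.norm ℝ hz))
    refine h1.congr_of_eventuallyEq ?_
    filter_upwards [isOpen_ne.mem_nhds hz] with w hw
    rw [hn, mul_inv_cancel_right₀ (norm_ne_zero_iff.2 hw)]
  obtain ⟨l, hl⟩ := hEd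
  have hlz : l z = 0 := by
    have h1 : HasDerivAt (fun t : ℝ => E (z + t • z)) (l z) 0 := hl.hasLineDerivAt z
    refine h1.unique ((hasDerivAt_const (0 : ℝ) (E z)).congr_of_eventuallyEq ?_)
    filter_upwards [lt_mem_nhds (show (-1 : ℝ) < 0 by norm_num)] with t ht
    have ht1 : 0 < 1 + t := by linarith
    have h2 : z + t • z = ((1 + t : ℝ) : ℂ) * z := by
      rw [Complex.real_smul]; push_cast; ring
    have h3 : ((1 + t : ℝ) : ℂ) ≠ 0 := by exact_mod_cast ht1.ne'
    simp only [E]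
    rw [h2, norm_mul, Complex.norm_real, Real.norm_eq_abs, abs_of_pos ht1, Complex.ofReal_mul,
      mul_div_mul_left _ _ h3]
  have hF : HasFDerivAt (rotationStretch a h)
      (a • (E z • ContinuousLinearMap.id ℝ ℂ + l.smulRight z)) z := by
    have h1 : HasFDerivAt (fun w => a • (E w • w))
        (a • (E z • ContinuousLinearMap.id ℝ ℂ + l.smulRight z)) z :=
      (hl.smul (hasFDerivAt_id z)).const_smul a
    refine h1.congr_of_eventuallyEq (Eventually.of_forall fun w => ?_)
    simp [rotationStretch, E]
  have hz2 : l z = z.re * l 1 + z.im * l Complex.I := by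
    conv_lhs => rw [← Complex.re_add_im z]
    rw [map_add, ← smul_eq_mul, ← smul_eq_mul, ← smul_eq_mul, ← map_smul, ← map_smul]
    simp
  have ha2 : a.re * a.re + a.im * a.im = 1 := by
    rw [← Complex.normSq_apply, Complex.normSq_eq_norm_sq, ha, one_pow]
  rw [hF.fderiv, Complex.det_eq_of_real_linear]
  change _ = E z ^ 2
  simp
  rw [hlz] at hz2
  generalize l 1 = p at *
  generalize l Complex.I = q at *
  linear_combination (E z ^ 2) * ha2 - E z * (a.re * a.re + a.im * a.im) * hz2

theorem rotationStretch_iterate_one (ha : ‖a‖ = 1) (n : ℕ) :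
    (rotationStretch a h)^[n] 1 =
      Real.exp (∑ j ∈ Finset.range n, h (a ^ j)) * a ^ n := by
  induction n with
  | zero => simp
  | succ n ih =>
    have hpos : (Real.exp (∑ j ∈ Finset.range n, h (a ^ j)) : ℂ) ≠ 0 := by
      exact_mod_cast (Real.exp_pos _).ne'
    rw [Function.iterate_succ_apply', ih, rotationStretch, norm_mul, norm_pow, ha, one_pow, mul_one,
      Complex.norm_real, Real.norm_eq_abs, abs_of_pos (Real.exp_pos _),
      mul_div_cancel_left₀ _ hpos, Finset.sum_range_succ, Real.exp_add]
    push_cast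
    ring

end

/-! ### Transfer to the Euclidean plane and conclusion. -/

theorem exists_isQuasiconformalMap_bungeeSet_nonempty :
    ∃ f : EuclideanSpace ℝ (Fin 2) → EuclideanSpace ℝ (Fin 2),
      IsQuasiconformalMap f ∧ (bungeeSet f).Nonempty := by
  obtain ⟨a, h, M, ha, hM, hL, ⟨B, hB⟩, hunb⟩ := exists_rotation_birkhoffSum
  let e : ℂ ≃ₗᵢ[ℝ] EuclideanSpace ℝ (Fin 2) := Complex.orthonormalBasisOneI.repr
  set F := rotationStretch a h with hFdef
  have hF := rotationStretch_lipschitz ha hM hL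
  have hf : LipschitzWith (1 * ((Real.exp M * (1 + 2 * M)).toNNReal * 1)) (e ∘ F ∘ e.symm) :=
    e.lipschitz.comp (hF.comp e.symm.lipschitz)
  have hiter : ∀ n : ℕ, ‖(e ∘ F ∘ e.symm)^[n] (e 1)‖ =
      Real.exp (∑ j ∈ Finset.range n, h (a ^ j)) := fun n => by
    have hs : Function.Semiconj e F (e ∘ F ∘ e.symm) := fun z => by simp
    rw [← (hs.iterate_right n).eq, e.norm_map, rotationStretch_iterate_one ha, norm_mul, norm_pow,
      ha, one_pow, mul_one, Complex.norm_real, Real.norm_eq_abs, abs_of_pos (Real.exp_pos _)]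
  refine ⟨e ∘ F ∘ e.symm, ⟨?_, hf.isQuasiregularMap (δ := Real.exp (-M) ^ 2) (by positivity) ?_⟩,
    e 1, ?_⟩
  · exact e.toHomeomorph.isHomeomorph.comp
      ((rotationStretch_isHomeomorph ha hM hL).comp e.symm.toHomeomorph.isHomeomorph)
  · filter_upwards [hf.ae_differentiableAt, compl_mem_ae_iff.2 (measure_singleton 0)] with x hx hx0
    have hx0' : e.symm x ≠ 0 := by simpa using hx0
    have hFx : DifferentiableAt ℝ F (e.symm x) := by
      have h1 : F = e.symm ∘ (e ∘ F ∘ e.symm) ∘ e := by ext z; simp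
      rw [h1]
      refine e.symm.differentiable.differentiableAt.comp _ (DifferentiableAt.comp _ ?_
        e.differentiable.differentiableAt)
      simpa using hx
    have hd : HasFDerivAt (e ∘ F ∘ e.symm)
        ((e.toContinuousLinearEquiv : ℂ →L[ℝ] _) ∘L fderiv ℝ F (e.symm x) ∘L
          (e.symm.toContinuousLinearEquiv : _ →L[ℝ] ℂ)) x :=
      (e.toContinuousLinearEquiv.hasFDerivAt).comp x
        (hFx.hasFDerivAt.comp x e.symm.toContinuousLinearEquiv.hasFDerivAt)
    have hdet : (fderiv ℝ (e ∘ F ∘ e.symm) x).det = (fderiv ℝ F (e.symm x)).det := by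
      rw [hd.fderiv]
      exact LinearMap.det_conj (fderiv ℝ F (e.symm x) : ℂ →ₗ[ℝ] ℂ) e.toLinearEquiv
    rw [hdet, rotationStretch_det_fderiv ha hx0' hFx]
    gcongr
    exact (abs_le.1 (hM _ (norm_div_norm_le_one _))).1
  -- Frequent sums at most `B` rule out escape; sums unbounded above rule out a bounded orbit.
  · rintro (hesc | hbdd)
    · have h1 := (tendsto_norm_atTop_iff_cobounded.2 hesc).eventually_gt_atTop (Real.exp B)
      obtain ⟨n, hn, hn'⟩ := (hB.and_eventually h1).exists
      rw [hiter] at hn'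
      exact absurd (Real.exp_lt_exp.1 hn') (not_lt.2 hn)
    · obtain ⟨R, hR⟩ := (isBounded_iff_forall_norm_le (E := EuclideanSpace ℝ (Fin 2))).1 hbdd
      obtain ⟨n, hn⟩ := hunb R
      have h1 := hR _ ⟨n, rfl⟩
      rw [hiter] at h1
      linarith [Real.add_one_le_exp (∑ j ∈ Finset.range n, h (a ^ j))]

theorem mainTheorem4 :
    (∃ f : EuclideanSpace ℝ (Fin 2) → EuclideanSpace ℝ (Fin 2),
      IsQuasiconformalMap f ∧ (bungeeSet f).Nonempty) ∧
    (∀ g : ℂ → ℂ, IsHomeomorph g → Differentiable ℂ g → bungeeSet g = ∅) := by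
  refine ⟨exists_isQuasiconformalMap_bungeeSet_nonempty, fun g hg hd => ?_⟩
  obtain ⟨a, b, hab⟩ := hg.exists_eq_affine hd
  exact bungeeSet_eq_empty_of_affine hab
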